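/- A DAG task consists of a finite directed acyclic graph with $N$ vertices, worst-case execution times $c(v)\ge 0$, a period $T$ and a relative deadline $0<D\le T$. Let $C=\sum_v c(v)$, let $L$ be the largest total execution time along a chain of the graph, and suppose that the task is heavy, i.e. $C/D>1$, and that $L<D$. Put $\gamma=\frac{C-L}{D-L}$. The first semi-federated algorithm executes each release of the task through $\lfloor\gamma\rfloor$ container tasks of load bound $1$ (its dedicated processors) and one container task of load bound $\gamma-\lfloor\gamma\rfloor$ (absent if this number is $0$). At runtime, a container $p$ with load bound $\delta_p$ to which a vertex is assigned is occupied until time reaches its absolute deadline $d_p$; otherwise it is empty, and all containers are empty at the time of release. A vertex is eligible if it has not been dispatched and all its predecessors are finished; a dispatched vertex may finish at any time. Whenever, at a time $t$, there are both an eligible vertex and an empty container, the dispatcher takes an arbitrary eligible vertex $v$ and an empty container $p$ with the largest load bound, and lets $d'$ be the earliest deadline of the occupied containers with load bound strictly larger than $\delta_p$ ($d'=\infty$ if there are none). If $d'>t+c(v)/\delta_p$, then $v$ is assigned to $p$ with $d_p=t+c(v)/\delta_p$. Otherwise $v$ is split into $v'$ and $v''$ with $c(v')=(d'-t)\delta_p$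 and $c(v'')=c(v)-c(v')$, where $v'$ inherits the incoming and $v''$ the outgoing edges of $v$, and an edge from $v'$ to $v''$ is added; $v'$ is assigned to $p$ with $d_p=d'$, and $v''$ awaits dispatching. Each split thus creates one extra vertex. Then in every run of the dispatcher on one release of the task, the number of extra vertices created is at all times at most $N$, the number of vertices of the original DAG. -/

import Mathlib

/-- A recurrent DAG task with vertex set `V`, worst-case execution times `wcet`, a period and a
constrained relative deadline. Zero-length (dummy) vertices are allowed. -/
structure DagTask (V : Type*) where
  /-- `prec u v`: there is an edge from `u` to `v`, i.e. `v` can only start after `u` finished. -/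
  prec : V → V → Prop
  acyclic : ∀ v, ¬ Relation.TransGen prec v v
  wcet : V → ℝ
  wcet_nonneg : ∀ v, 0 ≤ wcet v
  period : ℝ
  deadline : ℝ
  deadline_pos : 0 < deadline
  deadline_le_period : deadline ≤ period

namespace DagTask

variable {V : Type*} [Fintype V]

/-- Total worst-case execution time `C` of the task. -/
def totalWork (τ : DagTask V) : ℝ := ∑ v, τ.wcet v

/-- Length `L` of a longest chain of the task (since the graph is finite and acyclic, the set
below is finite and contains `0`). -/
noncomputable def critLength (τ : DagTask V) : ℝ :=
  sSup {x : ℝ | ∃ l : List V, l.IsChain τ.prec ∧ x = (l.map τ.wcet).sum}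

/-- A task is heavy when its density `C / D` is larger than `1`. -/
def Heavy (τ : DagTask V) : Prop := 1 < τ.totalWork / τ.deadline

/-- The minimal capacity requirement `γ = (C - L) / (D - L)`. -/
noncomputable def gamma (τ : DagTask V) : ℝ :=
  (τ.totalWork - τ.critLength) / (τ.deadline - τ.critLength)

/-- Number `⌊γ⌋` of dedicated processors which the first semi-federated algorithm grants to a
heavy task. -/
noncomputable def dedicated (τ : DagTask V) : ℕ := ⌊τ.gamma⌋₊

/-- Load bound `γ - ⌊γ⌋` of the additional container task which the first semi-federated
algorithm creates for a heavy task. -/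
noncomputable def fracLoad (τ : DagTask V) : ℝ := τ.gamma - ⌊τ.gamma⌋₊

/-- The container tasks through which a heavy task is executed under the first semi-federated
algorithm: one for each dedicated processor, and a single fractional one (a container with load
bound `0` has no capacity, so that it is absent when `γ` is an integer). -/
abbrev FirstContainer (τ : DagTask V) : Type :=
  Fin τ.dedicated ⊕ {_u : Unit // 0 < τ.fracLoad}

/-- Load bounds of the container tasks: `1` on the dedicated processors. -/
noncomputable def firstLoad (τ : DagTask V) : τ.FirstContainer → ℝ
  | Sum.inl _ => 1
  | Sum.inr _ => τ.fracLoad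

end DagTask

/-- Runtime state of one release of a DAG task that is executed through container tasks `ι`.
The vertices are labelled `Sum.inl v` (the original ones) and `Sum.inr j` (those created by
splitting). -/
structure DispState (V ι : Type*) where
  /-- the current time -/
  time : ℝ
  /-- vertices, execution times and precedence edges of the current DAG -/
  verts : Finset (V ⊕ ℕ)
  wcet : V ⊕ ℕ → ℝ
  prec : V ⊕ ℕ → V ⊕ ℕ → Prop
  /-- the set `S` of vertices that have not been dispatched yet -/
  pending : Finset (V ⊕ ℕ)
  /-- the vertices whose execution is finished -/
  finished : Finset (V ⊕ ℕ)
  /-- absolute deadline `d_p` and vertex `exe_p` last assigned to container `p` -/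
  deadline : ι → ℝ
  exe : ι → Option (V ⊕ ℕ)

namespace DispState

variable {V ι : Type*}

/-- A container is occupied from the moment a vertex is assigned to it until time reaches its
absolute deadline; otherwise it is empty. -/
def Occupied (s : DispState V ι) (p : ι) : Prop :=
  s.exe p ≠ none ∧ s.time < s.deadline p

/-- A vertex is eligible when it awaits execution and all its predecessors are finished. -/
def Eligible (s : DispState V ι) (v : V ⊕ ℕ) : Prop :=
  v ∈ s.pending ∧ ∀ u, s.prec u v → u ∈ s.finished

/-- `p` is an empty container with the largest load bound among the empty ones. -/
def FastestEmpty (load : ι → ℝ) (s : DispState V ι) (p : ι) : Prop :=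
  ¬ s.Occupied p ∧ ∀ q, ¬ s.Occupied q → load q ≤ load p

/-- `q` is an occupied container with load bound strictly larger than that of `p`, and its
deadline is the earliest among those: it is the deadline `d'` seen by the dispatcher. -/
def EarliestFaster (load : ι → ℝ) (s : DispState V ι) (p q : ι) : Prop :=
  (s.Occupied q ∧ load p < load q) ∧
    ∀ r, s.Occupied r → load p < load r → s.deadline q ≤ s.deadline r

/-- Initial state of a release at time `r`: all containers are empty, and nothing has been
dispatched. -/
def init [Fintype V] (τ : DagTask V) (ι : Type*) (r : ℝ) : DispState V ι where
  time := r
  verts := Finset.univ.map Function.Embedding.inl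
  wcet := Sum.elim τ.wcet fun _ => 0
  prec a b := ∃ u v, a = Sum.inl u ∧ b = Sum.inl v ∧ τ.prec u v
  pending := Finset.univ.map Function.Embedding.inl
  finished := ∅
  deadline _ := r
  exe _ := none

/-- Vertex `v` is removed from `S` and occupies container `p` with absolute deadline `d`. -/
def assign [DecidableEq V] [DecidableEq ι] (s : DispState V ι) (v : V ⊕ ℕ) (p : ι) (d : ℝ) :
    DispState V ι :=
  { s with
    pending := s.pending.erase v
    deadline := Function.update s.deadline p d
    exe := Function.update s.exe p (some v) }

/-- Vertex `v` is split into `v'` (which keeps the label `v` and the incoming edges) with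
execution time `x`, and `v''` (with the new label `w`, and the outgoing edges of `v`) with the
remaining execution time; an edge from `v'` to `v''` is added, and `v''` is put into `S`. -/
def splitVertex [DecidableEq V] (s : DispState V ι) (v w : V ⊕ ℕ) (x : ℝ) : DispState V ι :=
  { s with
    verts := insert w s.verts
    wcet := Function.update (Function.update s.wcet w (s.wcet v - x)) v x
    prec := fun a b => (a = v ∧ b = w) ∨ (a = w ∧ s.prec v b) ∨ (a ≠ v ∧ s.prec a b)
    pending := insert w s.pending }

/-- One step at runtime. The containers are scheduled on the processors together with other
tasks, and execution times may be shorter than the worst case, so that a dispatched vertex may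
finish at any moment. -/
inductive Step [DecidableEq V] [DecidableEq ι] (load : ι → ℝ) :
    DispState V ι → DispState V ι → Prop
  /-- The dispatcher puts an entire eligible vertex into the fastest empty container, since its
  deadline will be before the deadlines of all strictly faster occupied containers. -/
  | whole (s : DispState V ι) (v : V ⊕ ℕ) (p : ι)
      (hv : s.Eligible v) (hp : s.FastestEmpty load p)
      (h : ∀ q, s.Occupied q → load p < load q →
        s.time + s.wcet v / load p < s.deadline q) :
      Step load s (s.assign v p (s.time + s.wcet v / load p))
  /-- Otherwise the dispatcher splits the vertex, so that the deadline of the first part is the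
  earliest deadline `d'` of the strictly faster occupied containers. -/
  | split (s : DispState V ι) (v : V ⊕ ℕ) (p q : ι) (j : ℕ)
      (hv : s.Eligible v) (hp : s.FastestEmpty load p)
      (hq : s.EarliestFaster load p q)
      (h : s.deadline q ≤ s.time + s.wcet v / load p)
      (hj : Sum.inr j ∉ s.verts) :
      Step load s
        ((s.splitVertex v (Sum.inr j) ((s.deadline q - s.time) * load p)).assign v p
          (s.deadline q))
  /-- A dispatched vertex finishes its execution. -/
  | finish (s : DispState V ι) (v : V ⊕ ℕ) (hv : v ∈ s.verts) (hd : v ∉ s.pending) :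
      Step load s { s with finished := insert v s.finished }
  /-- Time advances, but only when the dispatcher is not invoked (it is invoked as soon as there
  are both an eligible vertex and an empty container), and at most to the next deadline. -/
  | advance (s : DispState V ι) (t : ℝ) (ht : s.time < t)
      (hidle : ¬ ((∃ v, s.Eligible v) ∧ ∃ p, ¬ s.Occupied p))
      (hd : ∀ p, s.Occupied p → t ≤ s.deadline p) :
      Step load s { s with time := t }

/-- The states that can be reached in a release of `τ` at time `r` under runtime dispatching to
containers with the given load bounds. -/
def Reachable [Fintype V] [DecidableEq V] [DecidableEq ι] (τ : DagTask V) (load : ι → ℝ)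
    (r : ℝ) (s : DispState V ι) : Prop :=
  Relation.ReflTransGen (Step load) (init τ ι r) s

/-- The extra vertices, i.e. the vertices of the current DAG that were created by splitting. -/
def extraVertices (s : DispState V ι) : Finset ℕ := s.verts.toRight

end DispState

namespace DispState

variable {V α β : Type*}

/-! Only the fractional (right) container has a strictly faster one, so only vertices sent there are
split. A split gives it the deadline of an occupied dedicated (left) container, so it stays occupied
until then, and that occupation can never cause a second split. An occupation of a dedicated
container consumes a pending vertex and creates none, whereas a split leaves the number of pending
vertices unchanged. Hence the sum of extra vertices, pending vertices and `chargeable` containers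
never grows (`SplitInvariant.step`), and it starts at `N`. -/

/-- The left containers whose current occupation outlasts the present moment and all deadlines of
right containers: those that can still become the reason for a split. -/
noncomputable def chargeable [Fintype α] (s : DispState V (α ⊕ β)) : Finset α :=
  open scoped Classical in
  Finset.univ.filter fun a =>
    s.time < s.deadline (Sum.inl a) ∧ ∀ b, s.deadline (Sum.inr b) < s.deadline (Sum.inl a)

theorem mem_chargeable [Fintype α] {s : DispState V (α ⊕ β)} {a : α} :
    a ∈ s.chargeable ↔
      s.time < s.deadline (Sum.inl a) ∧
        ∀ b, s.deadline (Sum.inr b) < s.deadline (Sum.inl a) := by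
  simp [chargeable]

/-- The invariant behind the bound on the number of splits: every split is charged to an
occupation of a left container, and every such occupation uses up a pending vertex. -/
structure SplitInvariant [Fintype α] (N : ℕ) (s : DispState V (α ⊕ β)) : Prop where
  pending_subset : s.pending ⊆ s.verts
  deadline_le : ∀ p, s.exe p = none → s.deadline p ≤ s.time
  card_le : s.extraVertices.card + s.pending.card + s.chargeable.card ≤ N

theorem SplitInvariant.init [Fintype V] [Fintype α] (τ : DagTask V) (r : ℝ) :
    SplitInvariant (Fintype.card V) (DispState.init τ (α ⊕ β) r) where
  pending_subset := subset_rfl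
  deadline_le _ _ := le_rfl
  card_le := by
    have hE : (DispState.init τ (α ⊕ β) r).extraVertices = ∅ := by
      ext j; simp [extraVertices, DispState.init]
    have hK : (DispState.init τ (α ⊕ β) r).chargeable = ∅ := by
      ext a; simp [mem_chargeable, DispState.init]
    rw [hE, hK]
    simp [DispState.init]

/-- Bridges `Occupied`, which also looks at `exe`, and `chargeable`, which compares deadlines only.
-/
theorem SplitInvariant.deadline_le_of_not_occupied [Fintype α] {N : ℕ}
    {s : DispState V (α ⊕ β)} (hs : SplitInvariant N s) {p : α ⊕ β} (hp : ¬ s.Occupied p) :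
    s.deadline p ≤ s.time := by
  by_cases h : s.exe p = none
  · exact hs.deadline_le p h
  · exact not_lt.1 fun hlt => hp ⟨h, hlt⟩

variable [DecidableEq V] [DecidableEq (α ⊕ β)]

theorem exe_eq_none_of_assign {s : DispState V (α ⊕ β)} {v : V ⊕ ℕ} {p q : α ⊕ β} {d : ℝ}
    (h : (s.assign v p d).exe q = none) : q ≠ p ∧ s.exe q = none := by
  by_cases hq : q = p
  · subst hq; simp [assign] at h
  · exact ⟨hq, by simpa [assign, hq] using h⟩

theorem deadline_assign_le {s : DispState V (α ⊕ β)} {v : V ⊕ ℕ} {p : α ⊕ β} {d : ℝ}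
    (hs : ∀ q, s.exe q = none → s.deadline q ≤ s.time) :
    ∀ q, (s.assign v p d).exe q = none →
      (s.assign v p d).deadline q ≤ (s.assign v p d).time := by
  intro q hq
  obtain ⟨hqp, hq⟩ := exe_eq_none_of_assign hq
  simpa [assign, hqp] using hs q hq

/-- Assigning a vertex to an empty left container adds at most that container to the chargeable
ones. -/
theorem card_chargeable_assign_inl [Fintype α] (s : DispState V (α ⊕ β)) (v : V ⊕ ℕ) (a : α)
    (d : ℝ) : (s.assign v (Sum.inl a) d).chargeable.card ≤ s.chargeable.card + 1 := by
  classical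
  refine (Finset.card_le_card ?_).trans (Finset.card_insert_le a _)
  intro c hc
  by_cases hca : c = a
  · simp [hca]
  · rw [mem_chargeable] at hc
    simpa [mem_chargeable, assign, hca] using hc

/-- Assigning a vertex to an empty right container, if it is the only one, does not create
chargeable containers; those remaining have deadlines after that of the right container. -/
theorem mem_chargeable_assign_inr [Fintype α] [Subsingleton β] {s : DispState V (α ⊕ β)}
    {v : V ⊕ ℕ} {b : β} {d : ℝ} (hb : s.deadline (Sum.inr b) ≤ s.time) {c : α}
    (hc : c ∈ (s.assign v (Sum.inr b) d).chargeable) :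
    c ∈ s.chargeable ∧ d < s.deadline (Sum.inl c) := by
  rw [mem_chargeable] at hc
  have h1 : s.time < s.deadline (Sum.inl c) := by simpa [assign] using hc.1
  refine ⟨mem_chargeable.2 ⟨h1, fun b' => ?_⟩, by simpa [assign] using hc.2 b⟩
  rw [Subsingleton.elim b' b]
  exact hb.trans_lt h1

/-- A whole dispatch trades a pending vertex for at most one chargeable container; a split trades at
least one chargeable container for an extra vertex. -/
theorem SplitInvariant.step [Fintype α] [Subsingleton β] {load : α ⊕ β → ℝ}
    (hload : ∀ p q, load p < load q → (∃ b, p = Sum.inr b) ∧ ∃ a, q = Sum.inl a) {N : ℕ}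
    {s t : DispState V (α ⊕ β)} (hs : SplitInvariant N s) (h : Step load s t) :
    SplitInvariant N t := by
  cases h with
  | whole v p hv hp h =>
    refine ⟨(Finset.erase_subset _ _).trans hs.pending_subset, deadline_assign_le hs.deadline_le,
      ?_⟩
    have hP : (s.pending.erase v).card + 1 = s.pending.card := Finset.card_erase_add_one hv.1
    have hK : (s.assign v p (s.time + s.wcet v / load p)).chargeable.card
        ≤ s.chargeable.card + 1 := by
      rcases p with a | b
      · exact card_chargeable_assign_inl s v a _
      · refine (Finset.card_le_card fun c hc => ?_).trans (Nat.le_succ _)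
        exact (mem_chargeable_assign_inr (hs.deadline_le_of_not_occupied hp.1) hc).1
    have := hs.card_le
    change s.extraVertices.card + (s.pending.erase v).card + _ ≤ N
    omega
  | split v p q j hv hp hq h hj =>
    obtain ⟨⟨b, rfl⟩, a, rfl⟩ := hload p q hq.1.2
    have hb := hs.deadline_le_of_not_occupied hp.1
    set x := (s.deadline (Sum.inl a) - s.time) * load (Sum.inr b)
    refine ⟨(Finset.erase_subset _ _).trans (Finset.insert_subset_insert _ hs.pending_subset),
      deadline_assign_le (s := s.splitVertex v (Sum.inr j) x) hs.deadline_le, ?_⟩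
    -- The second part replaces the dispatched first part; its label is fresh because pending
    -- vertices lie in `verts`.
    have hP : ((insert (Sum.inr j) s.pending).erase v).card + 1
        = s.pending.card + 1 := by
      rw [Finset.card_erase_add_one (Finset.mem_insert_of_mem hv.1),
        Finset.card_insert_of_notMem fun hm => hj (hs.pending_subset hm)]
    have hE : (insert (Sum.inr j) s.verts).toRight.card ≤ s.extraVertices.card + 1 := by
      rw [Finset.toRight_insert_inr]
      exact Finset.card_insert_le _ _
    have hK : ((s.splitVertex v (Sum.inr j) x).assign v (Sum.inr b)
        (s.deadline (Sum.inl a))).chargeable.card < s.chargeable.card := by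
      have key : ∀ c ∈ ((s.splitVertex v (Sum.inr j) x).assign v (Sum.inr b)
          (s.deadline (Sum.inl a))).chargeable,
          c ∈ s.chargeable ∧ s.deadline (Sum.inl a) < s.deadline (Sum.inl c) := fun c hc =>
        mem_chargeable_assign_inr (s := s.splitVertex v (Sum.inr j) x) hb hc
      -- The container `a` that caused the split drops out: the right deadline now equals its own,
      -- and `chargeable` demands strict inequality. It was chargeable before, since the right
      -- container was empty.
      refine Finset.card_lt_card (Finset.ssubset_iff_of_subset (fun c hc => (key c hc).1) |>.2
        ⟨a, mem_chargeable.2 ⟨hq.1.1.2, fun b' => ?_⟩, fun ha => lt_irrefl _ (key a ha).2⟩)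
      rw [Subsingleton.elim b' b]
      exact hb.trans_lt hq.1.1.2
    have := hs.card_le
    change (insert (Sum.inr j) s.verts).toRight.card
      + ((insert (Sum.inr j) s.pending).erase v).card + _ ≤ N
    omega
  | finish v hv hd => exact ⟨hs.pending_subset, hs.deadline_le, hs.card_le⟩
  | advance t ht hidle hd =>
    refine ⟨hs.pending_subset, fun p hp => (hs.deadline_le p hp).trans ht.le, ?_⟩
    -- Deadlines stay fixed while time grows, so containers can only leave `chargeable`.
    refine (Nat.add_le_add_left (Finset.card_le_card fun c hc => ?_) _).trans hs.card_le
    rw [mem_chargeable] at hc ⊢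
    exact ⟨ht.trans hc.1, hc.2⟩

/-- If only right containers are slower than others, only left ones are faster than others, and
there is at most one right container, a release creates at most as many extra vertices as the
task has vertices. -/
theorem Reachable.card_extraVertices_le [Fintype V] [Fintype α] [Subsingleton β]
    {load : α ⊕ β → ℝ}
    (hload : ∀ p q, load p < load q → (∃ b, p = Sum.inr b) ∧ ∃ a, q = Sum.inl a)
    {τ : DagTask V} {r : ℝ} {s : DispState V (α ⊕ β)} (hs : Reachable τ load r s) :
    s.extraVertices.card ≤ Fintype.card V := by
  have inv : SplitInvariant (Fintype.card V) s := by
    induction hs with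
    | refl => exact .init τ r
    | tail _ h ih => exact ih.step hload h
  have := inv.card_le
  omega

end DispState

theorem DagTask.fracLoad_lt_one {V : Type*} [Fintype V] (τ : DagTask V) : τ.fracLoad < 1 := by
  have := Nat.lt_floor_add_one τ.gamma
  unfold DagTask.fracLoad
  linarith

/-- Loads take only the values `1` (left) and `fracLoad < 1` (right), so a strict inequality
determines both sides. -/
theorem DagTask.firstLoad_lt {V : Type*} [Fintype V] (τ : DagTask V) (p q : τ.FirstContainer)
    (h : τ.firstLoad p < τ.firstLoad q) : (∃ b, p = Sum.inr b) ∧ ∃ a, q = Sum.inl a := by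
  have := τ.fracLoad_lt_one
  rcases p with a | b <;> rcases q with c | d <;> simp only [DagTask.firstLoad] at h
  · exact absurd h (lt_irrefl _)
  · linarith
  · exact ⟨⟨b, rfl⟩, c, rfl⟩
  · exact absurd h (lt_irrefl _)

theorem theoremt {V : Type*} [Fintype V] [DecidableEq V] (τ : DagTask V)
    (hheavy : τ.Heavy) (hL : τ.critLength < τ.deadline)
    (r : ℝ) (s : DispState V τ.FirstContainer)
    (hs : DispState.Reachable τ τ.firstLoad r s) :
    s.extraVertices.card ≤ Fintype.card V :=
  DispState.Reachable.card_extraVertices_le τ.firstLoad_lt hs
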